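/- An overpartition of $n$ is a partition of $n$ in which the first occurrence of each part size may be overlined. An overpartition triple of $n$ is an ordered triple $(\omega_1,\omega_2,\omega_3)$ of (possibly empty) overpartitions such that the sum of all their parts is $n$. Let $\overline{p}_3(n)$ denote the number of overpartition triples of $n$ (so $\overline{p}_3(0)=1$). Then for all nonnegative integers $\alpha$ and $n$, $$\overline{p}_3(7\cdot 4^{\alpha+1}n)\equiv (-1)^n\,\overline{p}_3(7n)\pmod 7$$ and $$\overline{p}_3\big(4^{\alpha}(56n+49)\big)\equiv 0\pmod 7.$$ -/

import Mathlib

/-- An overpartition of `n`: a partition of `n` in which the first occurrence of each part size may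
be overlined. It is recorded as the partition together with the set of those part sizes whose first
occurrence is overlined. -/
structure Overpartition (n : ℕ) extends Nat.Partition n where
  /-- the part sizes whose first occurrence is overlined -/
  overlined : Finset ℕ
  overlined_subset : overlined ⊆ parts.toFinset

/-- An overpartition `k`-tuple of `n`: an ordered `k`-tuple `(ω₁, …, ω_k)` of overpartitions (some
of which may be empty) such that the sum of all the parts is `n`. Here `size i` is the sum of the
parts of the `i`-th overpartition. -/
structure OverpartitionTuple (k n : ℕ) where
  /-- the sums of the parts of the components -/
  size : Fin k → ℕ
  sum_size : ∑ i, size i = n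
  /-- the components -/
  component : ∀ i, Overpartition (size i)

/-- The number of overpartition `k`-tuples of `n` (these are finite in number, see below). -/
noncomputable def overpartitionTupleCount (k n : ℕ) : ℕ :=
  Nat.card (OverpartitionTuple k n)

instance Overpartition.instFinite (n : ℕ) : Finite (Overpartition n) := by
  let f : Overpartition n → Σ p : n.Partition, {s : Finset ℕ // s ∈ p.parts.toFinset.powerset} :=
    fun ω => ⟨ω.toPartition, ω.overlined, Finset.mem_powerset.2 ω.overlined_subset⟩
  refine Finite.of_injective f ?_
  rintro ⟨p, s, hs⟩ ⟨p', s', hs'⟩ h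
  simp only [f, Sigma.mk.injEq] at h
  obtain ⟨rfl, h⟩ := h
  simpa using h

instance OverpartitionTuple.instFinite (k n : ℕ) : Finite (OverpartitionTuple k n) := by
  let f : OverpartitionTuple k n →
      Σ s : {s : Fin k → ℕ // s ∈ Finset.Nat.antidiagonalTuple k n}, ∀ i, Overpartition (s.1 i) :=
    fun ω => ⟨⟨ω.size, Finset.Nat.mem_antidiagonalTuple.2 ω.sum_size⟩, ω.component⟩
  refine Finite.of_injective f ?_
  rintro ⟨s, hs, c⟩ ⟨s', hs', c'⟩ h
  simp only [f, Sigma.mk.injEq, Subtype.mk.injEq] at h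
  obtain ⟨rfl, h⟩ := h
  simpa using h

/-- The only overpartition `k`-tuple of `0` is the tuple of empty overpartitions. -/
theorem overpartitionTupleCount_zero (k : ℕ) : overpartitionTupleCount k 0 = 1 := by
  have key : ∀ ω : Overpartition 0, ω.parts = 0 ∧ ω.overlined = ∅ := by
    intro ω
    have h : ω.parts = 0 := by
      refine Multiset.eq_zero_of_forall_notMem fun m hm => ?_
      have h1 := Nat.Partition.le_of_mem_parts hm
      have h2 := ω.parts_pos hm
      omega
    refine ⟨h, ?_⟩
    have h3 := ω.overlined_subset
    rw [h] at h3
    simpa using h3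
  have hsub : Subsingleton (Overpartition 0) := by
    refine ⟨fun ω ω' => ?_⟩
    obtain ⟨h1, h2⟩ := key ω
    obtain ⟨h3, h4⟩ := key ω'
    rcases ω with ⟨⟨p, _, _⟩, s, _⟩
    rcases ω' with ⟨⟨p', _, _⟩, s', _⟩
    simp only at h1 h2 h3 h4
    subst h1 h2 h3 h4
    rfl
  rw [overpartitionTupleCount, Nat.card_eq_one_iff_unique]
  refine ⟨⟨?_⟩, ⟨⟨fun _ => 0, by simp, fun _ => ⟨⟨0, by simp, by simp⟩, ∅, by simp⟩⟩⟩⟩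
  rintro ⟨s, hs, c⟩ ⟨s', hs', c'⟩
  obtain rfl : s = fun _ => 0 := by
    funext i
    simpa using (Finset.sum_eq_zero_iff.1 hs) i (Finset.mem_univ i)
  obtain rfl : s' = fun _ => 0 := by
    funext i
    simpa using (Finset.sum_eq_zero_iff.1 hs') i (Finset.mem_univ i)
  obtain rfl : c = c' := funext fun i => hsub.elim _ _
  rfl

/-! Let `φ = ∑ (-1)^x q^(x²)` over all integers `x`. Gauss's identity makes `φ` the inverse of the
overpartition series, so triples have generating function `φ⁻³ = φ⁴ / φ⁷`. Modulo 7, `φ(q)⁷ =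
φ(q⁷)`, hence extracting the exponents divisible by 7 touches only `φ⁴`, whose coefficients are
`(-1)^n r₄(n)`, with `r_k` counting representations by `k` squares. Since `r₄(7n) ≡ r₄(n)`
(`card_sumSqRep_four_seven_mul`, by integral quaternions of norm 7), the extracted series is `φ⁴ / φ
= φ³`, that is, `p̄₃(7n) ≡ (-1)^n r₃(n)` (`overpartitionTupleCount_three_seven_mul`). Both claims
follow from `r₃(4n) = r₃(n)` and `r₃(8n+7) = 0`. -/

/-! ### Generating functions of tuples and of overpartitions. -/

section GeneratingFunctions

open PowerSeries

/-- The coefficients of powers of a generating function of finite families count tuples. -/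
theorem coeff_mk_card_pow (R : Type*) [CommSemiring R] (F : ℕ → Type*) [∀ m, Finite (F m)]
    (k n : ℕ) :
    coeff n ((PowerSeries.mk fun m => (Nat.card (F m) : R)) ^ k) =
      (Nat.card (Σ s : {s : Fin k → ℕ // ∑ i, s i = n}, ∀ i, F (s.1 i)) : R) := by
  classical
  have hfin : Finite {s : Fin k → ℕ // ∑ i, s i = n} :=
    Finite.of_injective (β := {s // s ∈ Finset.Nat.antidiagonalTuple k n})
      (fun s => ⟨s.1, Finset.Nat.mem_antidiagonalTuple.2 s.2⟩)
      fun s t h => Subtype.ext (congrArg (fun u => u.1) h)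
  have := Fintype.ofFinite {s : Fin k → ℕ // ∑ i, s i = n}
  have hpow : (PowerSeries.mk fun m => (Nat.card (F m) : R)) ^ k =
      ∏ _i : Fin k, PowerSeries.mk fun m => (Nat.card (F m) : R) := by simp
  rw [hpow, coeff_prod, Nat.card_sigma]
  simp only [coeff_mk, Nat.card_pi]
  push_cast
  refine Finset.sum_bij' (fun l hl => ⟨l, by simpa using (Finset.mem_finsuppAntidiag.1 hl).1⟩)
    (fun s _ => Finsupp.equivFunOnFinite.symm s.1) ?_ ?_ ?_ ?_ ?_
  · intros; simp
  · intro s _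
    simp [Finset.mem_finsuppAntidiag, s.2]
  · intro l _
    ext; simp
  · intro s _
    ext; simp
  · intros; rfl

/-- Overpartition tuples are tuples of overpartitions, graded by their sizes. -/
def OverpartitionTuple.equivSigma (k n : ℕ) : OverpartitionTuple k n ≃
    Σ s : {s : Fin k → ℕ // ∑ i, s i = n}, ∀ i, Overpartition (s.1 i) where
  toFun ω := ⟨⟨ω.size, ω.sum_size⟩, ω.component⟩
  invFun ω := ⟨ω.1.1, ω.1.2, ω.2⟩
  left_inv _ := rfl
  right_inv _ := rfl

/-- Overpartitions are partitions with a marked set of part sizes. -/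
def Overpartition.equivSigma (n : ℕ) : Overpartition n ≃
    Σ p : n.Partition, {s : Finset ℕ // s ∈ p.parts.toFinset.powerset} where
  toFun ω := ⟨ω.toPartition, ω.overlined, Finset.mem_powerset.2 ω.overlined_subset⟩
  invFun ω := ⟨ω.1, ω.2.1, Finset.mem_powerset.1 ω.2.2⟩
  left_inv _ := rfl
  right_inv _ := rfl

/-- The generating function of overpartitions. -/
noncomputable def overpartitionSeries (R : Type*) [CommSemiring R] : R⟦X⟧ :=
  PowerSeries.mk fun n => (Nat.card (Overpartition n) : R)

theorem coeff_overpartitionSeries_pow (R : Type*) [CommSemiring R] (k n : ℕ) :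
    coeff n (overpartitionSeries R ^ k) = (overpartitionTupleCount k n : R) := by
  rw [overpartitionSeries, coeff_mk_card_pow, overpartitionTupleCount,
    Nat.card_congr (OverpartitionTuple.equivSigma k n)]

/-- Each distinct part size is overlined or not, so it contributes a weight 2 whatever its
multiplicity. -/
theorem overpartitionSeries_eq_genFun (R : Type*) [CommSemiring R] :
    overpartitionSeries R = Nat.Partition.genFun fun _ _ => (2 : R) := by
  ext n
  rw [overpartitionSeries, coeff_mk, Nat.Partition.coeff_genFun,
    Nat.card_congr (Overpartition.equivSigma n), Nat.card_sigma]
  push_cast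
  refine Finset.sum_congr rfl fun p _ => ?_
  rw [Nat.card_eq_fintype_card, Fintype.card_coe, Finset.card_powerset]
  simp [Finsupp.prod]

/-! ### Gauss's square identity in finite, division-free form. -/

section Gauss

variable {R : Type*} [CommRing R]

/-- Telescoping sum behind the finite form of Gauss's square identity. -/
theorem sum_gauss_telescope (q : R) (c : ℕ → R)
    (hc : ∀ s, c (s + 1) * (1 - q ^ (s + 1)) = -((1 + q ^ s) * c s)) (m k : ℕ) :
    ∑ s ∈ Finset.range (k + 1), c s * (q ^ (s * (m + 1)) * (1 - q ^ m) - q ^ (s * m) * (1 + q ^ m))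
      = c (k + 1) * (1 - q ^ (k + 1)) * q ^ ((k + 1) * m) := by
  induction k with
  | zero =>
    rw [hc]; simp; ring
  | succ k ih =>
    rw [Finset.sum_range_succ, ih, hc (k + 1)]
    ring

/-- A finite form of Gauss's identity `∑ (-1)ⁿ q^(n²) = ∏ (1 - qⁿ) / (1 + qⁿ)`. -/
theorem gauss_square_finite (q : R) (c : ℕ → R) (h0 : c 0 = 1)
    (hc : ∀ s, c (s + 1) * (1 - q ^ (s + 1)) = -((1 + q ^ s) * c s)) (n : ℕ) :
    (1 + 2 * ∑ s ∈ Finset.range n, (-1) ^ (s + 1) * q ^ ((s + 1) ^ 2)) *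
        ∏ j ∈ Finset.range n, (1 + q ^ (j + 1)) =
      (∏ j ∈ Finset.range n, (1 - q ^ (j + 1))) *
        ∑ s ∈ Finset.range (n + 1), c s * q ^ (s * (n + 1)) := by
  -- The recurrence solved with denominators cleared; the 2 is the factor `1 + q^0`.
  have hcE : ∀ n, c n * (∏ j ∈ Finset.range n, (1 - q ^ (j + 1))) * (1 + q ^ n) =
      2 * (-1) ^ n * ∏ j ∈ Finset.range n, (1 + q ^ (j + 1)) := by
    intro n
    induction n with
    | zero => simp [h0]; norm_num
    | succ n ih =>
      rw [Finset.prod_range_succ, Finset.prod_range_succ]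
      linear_combination (∏ j ∈ Finset.range n, (1 - q ^ (j + 1))) * (1 + q ^ (n + 1)) * hc n -
        (1 + q ^ (n + 1)) * ih
  induction n with
  | zero => simp [h0]
  | succ n ih =>
    -- This compares the sums with exponents `s(n+1)` and `s(n+2)`; the boundary term and the new
    -- summand, evaluated by `hE`, give the next theta term.
    have ht := sum_gauss_telescope q c hc (n + 1) n
    have hE := hcE (n + 1)
    rw [Finset.sum_congr rfl fun s _ => mul_sub _ _ _, Finset.sum_sub_distrib] at ht
    have e1 : ∑ s ∈ Finset.range (n + 1), c s * (q ^ (s * (n + 1 + 1)) * (1 - q ^ (n + 1))) =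
        (∑ s ∈ Finset.range (n + 1), c s * q ^ (s * (n + 1 + 1))) * (1 - q ^ (n + 1)) := by
      rw [Finset.sum_mul]; exact Finset.sum_congr rfl fun _ _ => by ring
    have e2 : ∑ s ∈ Finset.range (n + 1), c s * (q ^ (s * (n + 1)) * (1 + q ^ (n + 1))) =
        (∑ s ∈ Finset.range (n + 1), c s * q ^ (s * (n + 1))) * (1 + q ^ (n + 1)) := by
      rw [Finset.sum_mul]; exact Finset.sum_congr rfl fun _ _ => by ring
    rw [e1, e2] at ht
    rw [Finset.sum_range_succ _ n, Finset.sum_range_succ _ (n + 1)]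
    rw [Finset.prod_range_succ] at hE ⊢
    rw [Finset.prod_range_succ] at hE ⊢
    have hq : q ^ ((n + 1) * (n + 1 + 1)) = q ^ ((n + 1) ^ 2) * q ^ (n + 1) := by ring
    have hq2 : q ^ ((n + 1) * (n + 1)) = q ^ ((n + 1) ^ 2) := by ring
    rw [hq2] at ht
    rw [hq]
    linear_combination (1 + q ^ (n + 1)) * ih -
      (∏ j ∈ Finset.range n, (1 - q ^ (j + 1))) * ht - q ^ ((n + 1) ^ 2) * hE

end Gauss

end GeneratingFunctions

/-! ### The theta series and Gauss's identity as a limit. -/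

section Theta

open PowerSeries Filter Topology
open scoped PowerSeries.WithPiTopology

instance Int.finite_sq_eq (n : ℕ) : Finite {x : ℤ // x ^ 2 = n} := by
  refine Finite.of_injective (β := Set.Icc (-(n : ℤ)) n) (fun x => ⟨x.1, ?_, ?_⟩) ?_
  · nlinarith [x.2, Int.natCast_nonneg n]
  · nlinarith [x.2, Int.natCast_nonneg n]
  · intro x y h
    exact Subtype.ext (congrArg (fun u => u.1) h)

theorem Int.card_sq_eq_zero : Nat.card {x : ℤ // x ^ 2 = (0 : ℕ)} = 1 := by
  rw [Nat.card_eq_one_iff_exists]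
  exact ⟨⟨0, by simp⟩, fun x => Subtype.ext (by simpa using x.2)⟩

theorem Int.card_sq_eq_sq (m : ℕ) :
    Nat.card {x : ℤ // x ^ 2 = (((m + 1) ^ 2 : ℕ) : ℤ)} = 2 := by
  have h : {x : ℤ | x ^ 2 = (((m + 1) ^ 2 : ℕ) : ℤ)} = {((m : ℤ) + 1), -((m : ℤ) + 1)} := by
    ext x
    simp only [Set.mem_ofPred_eq, Set.mem_insert_iff, Set.mem_singleton_iff]
    push_cast
    exact sq_eq_sq_iff_eq_or_eq_neg
  change Set.ncard {x : ℤ | x ^ 2 = (((m + 1) ^ 2 : ℕ) : ℤ)} = 2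
  rw [h, Set.ncard_pair (by omega)]

theorem Int.card_sq_eq_of_forall_ne {n : ℕ} (h : ∀ m : ℕ, m ^ 2 ≠ n) :
    Nat.card {x : ℤ // x ^ 2 = n} = 0 := by
  rw [Nat.card_eq_zero]
  left
  refine ⟨fun x => h x.1.natAbs ?_⟩
  zify
  simpa using x.2

/-- The theta series `∑ q^(x²)`, the sum being over all integers `x`. -/
noncomputable def thetaSeries (R : Type*) [CommSemiring R] : R⟦X⟧ :=
  PowerSeries.mk fun n => (Nat.card {x : ℤ // x ^ 2 = n} : R)

theorem coeff_theta_partial_sum {R : Type*} [CommRing R] {n N : ℕ} (h : n ≤ N) :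
    coeff n (1 + 2 * ∑ s ∈ Finset.range N, (-1) ^ (s + 1) * (X : R⟦X⟧) ^ ((s + 1) ^ 2)) =
      coeff n (rescale (-1) (thetaSeries R)) := by
  have e : ∀ s : ℕ, (-1) ^ (s + 1) * (X : R⟦X⟧) ^ ((s + 1) ^ 2) =
      C ((-1) ^ (s + 1)) * X ^ ((s + 1) ^ 2) := by intro s; simp
  have e2 : (2 : R⟦X⟧) = C 2 := (map_ofNat C 2).symm
  simp_rw [e, e2]
  rw [map_add, coeff_C_mul, map_sum, coeff_one, coeff_rescale, thetaSeries, coeff_mk]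
  simp only [coeff_C_mul, coeff_X_pow]
  by_cases hn : ∃ m : ℕ, m ^ 2 = n
  · obtain ⟨m, rfl⟩ := hn
    rcases m with _ | m
    · rw [Finset.sum_eq_zero]
      · have := Int.card_sq_eq_zero
        simp_all
      · intro s _
        rw [if_neg (by positivity), mul_zero]
    · rw [Int.card_sq_eq_sq, Finset.sum_eq_single m]
      -- A square has the parity of its root, so the signs come from `q ↦ -q`.
      · have hs : ((-1 : R)) ^ ((m + 1) ^ 2) = (-1) ^ (m + 1) := by
          rw [sq, pow_mul]
          rcases Nat.even_or_odd (m + 1) with h | h <;> simp [h.neg_one_pow]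
        rw [hs]
        simp
        ring
      · intro b _ hb
        rw [if_neg, mul_zero]
        intro h'
        exact hb (by have := Nat.pow_left_injective (n := 2) (by norm_num) h'; simp at this; omega)
      · intro hm
        exfalso
        apply hm
        rw [Finset.mem_range]
        nlinarith
  · push Not at hn
    rw [Int.card_sq_eq_of_forall_ne hn, Finset.sum_eq_zero]
    · have : n ≠ 0 := fun h0 => hn 0 (by simp [h0])
      simp [this]
    · intro s _
      rw [if_neg fun h' => hn _ h'.symm, mul_zero]

section Limit

variable (K : Type*) [Field K] [TopologicalSpace K]

theorem tendsto_theta_partial_sum :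
    Tendsto (fun N => 1 + 2 * ∑ s ∈ Finset.range N, (-1) ^ (s + 1) * (X : K⟦X⟧) ^ ((s + 1) ^ 2))
      atTop (𝓝 (rescale (-1) (thetaSeries K))) := by
  rw [WithPiTopology.tendsto_iff_coeff_tendsto]
  exact fun d => tendsto_atTop_of_eventually_const (i₀ := d) fun N hN => coeff_theta_partial_sum hN

variable [IsTopologicalRing K] [T2Space K]

/-- Geometric series: the Euler factor for part size `i + 1` is `(1 + q^(i+1)) / (1 - q^(i+1))`. -/
theorem overpartition_factor_mul (i : ℕ) :
    (1 + ∑' j : ℕ, (2 : K) • (X : K⟦X⟧) ^ ((i + 1) * (j + 1))) * (1 - X ^ (i + 1)) =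
      1 + X ^ (i + 1) := by
  have hs : Summable fun j : ℕ => ((X : K⟦X⟧) ^ (i + 1)) ^ j :=
    WithPiTopology.summable_pow_of_constantCoeff_eq_zero (by simp)
  have h1 : ∑' j : ℕ, (2 : K) • (X : K⟦X⟧) ^ ((i + 1) * (j + 1)) =
      2 * X ^ (i + 1) * ∑' j : ℕ, ((X : K⟦X⟧) ^ (i + 1)) ^ j := by
    rw [← hs.tsum_mul_left]
    refine tsum_congr fun j => ?_
    rw [smul_eq_C_mul, pow_mul, pow_succ]
    simp only [map_ofNat]
    ring
  have h2 : (∑' j : ℕ, ((X : K⟦X⟧) ^ (i + 1)) ^ j) * (1 - X ^ (i + 1)) = 1 :=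
    WithPiTopology.tsum_pow_mul_one_sub_of_constantCoeff_eq_zero (by simp)
  rw [h1]
  linear_combination 2 * X ^ (i + 1) * h2

/-- Gauss's identity: the alternating theta series is inverse to the overpartition series. -/
theorem rescale_theta_mul_overpartitionSeries :
    rescale (-1) (thetaSeries K) * overpartitionSeries K = 1 := by
  let c : ℕ → K⟦X⟧ := fun n => Nat.rec 1 (fun s y => -((1 + X ^ s) * y) * (1 - X ^ (s + 1))⁻¹) n
  have hc : ∀ s, c (s + 1) * (1 - X ^ (s + 1)) = -((1 + X ^ s) * c s) := by
    intro s
    change -((1 + X ^ s) * c s) * (1 - X ^ (s + 1))⁻¹ * (1 - X ^ (s + 1)) = _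
    rw [mul_assoc, PowerSeries.inv_mul_cancel _ (by simp), mul_one]
  have hT := tendsto_theta_partial_sum K
  have hG : Tendsto (fun N => ∏ i ∈ Finset.range N,
      (1 + ∑' j : ℕ, (2 : K) • (X : K⟦X⟧) ^ ((i + 1) * (j + 1)))) atTop
      (𝓝 (overpartitionSeries K)) := by
    rw [overpartitionSeries_eq_genFun]
    exact (Nat.Partition.hasProd_genFun fun _ _ => (2 : K)).tendsto_prod_nat
  -- Every term with `s ≥ 1` has order above `N`, so only `c 0 = 1` survives.
  have hS : Tendsto (fun N => ∑ s ∈ Finset.range (N + 1), c s * (X : K⟦X⟧) ^ (s * (N + 1))) atTop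
      (𝓝 1) := by
    rw [WithPiTopology.tendsto_iff_coeff_tendsto]
    refine fun d => tendsto_atTop_of_eventually_const (i₀ := d) fun N hN => ?_
    rw [Finset.sum_range_succ', map_add, map_sum, Finset.sum_eq_zero]
    · simp [c]
    · intro s _
      rw [coeff_mul_X_pow', if_neg]
      nlinarith
  refine tendsto_nhds_unique (hT.mul hG) (hS.congr fun N => ?_)
  have hD : ∏ j ∈ Finset.range N, (1 - (X : K⟦X⟧) ^ (j + 1)) ≠ 0 := by
    refine Finset.prod_ne_zero_iff.2 fun j _ h => ?_
    have := congrArg constantCoeff h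
    simp at this
  refine mul_left_cancel₀ hD ?_
  rw [← gauss_square_finite (X : K⟦X⟧) c rfl hc N]
  simp only [← overpartition_factor_mul K, Finset.prod_mul_distrib]
  ring

end Limit

end Theta

/-! ### Sums of three squares modulo 4 and 8. -/

section SumsOfSquares

open PowerSeries

theorem natAbs_sq_of_sq_eq {x : ℤ} {n : ℕ} (h : x ^ 2 = n) : x.natAbs ^ 2 = n := by
  zify
  simpa using h

/-- The representations of `n` as a sum of `k` squares of integers. -/
abbrev SumSqRep (k n : ℕ) : Type := {x : Fin k → ℤ // ∑ i, x i ^ 2 = n}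

/-- Representations as a sum of squares, graded by the sizes of the squares. -/
def sumSqRepToSigma (k n : ℕ) (x : SumSqRep k n) :
    Σ s : {s : Fin k → ℕ // ∑ i, s i = n}, ∀ i, {y : ℤ // y ^ 2 = s.1 i} :=
  ⟨⟨fun i => (x.1 i).natAbs ^ 2, by zify; simpa using x.2⟩, fun i => ⟨x.1 i, by simp⟩⟩

theorem sumSqRepToSigma_bijective (k n : ℕ) : Function.Bijective (sumSqRepToSigma k n) := by
  constructor
  · intro x y h
    have h' := congrArg (fun z => fun i => (z.2 i).1) h
    exact Subtype.ext h'
  · rintro ⟨⟨s, hs⟩, y⟩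
    obtain ⟨z, hz, rfl⟩ : ∃ (z : Fin k → ℤ) (hz : ∀ i, z i ^ 2 = s i), y = fun i => ⟨z i, hz i⟩ :=
      ⟨fun i => (y i).1, fun i => (y i).2, rfl⟩
    obtain rfl : s = fun i => (z i).natAbs ^ 2 :=
      funext fun i => (natAbs_sq_of_sq_eq (hz i)).symm
    refine ⟨⟨z, ?_⟩, rfl⟩
    rw [← hs]
    push_cast
    simp

theorem coeff_thetaSeries_pow (R : Type*) [CommSemiring R] (k n : ℕ) :
    coeff n (thetaSeries R ^ k) = (Nat.card (SumSqRep k n) : R) := by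
  rw [thetaSeries, coeff_mk_card_pow,
    Nat.card_congr (Equiv.ofBijective _ (sumSqRepToSigma_bijective k n))]

theorem four_dvd_sq_add_sq_add_sq {a b c : ℤ} (h : (4 : ℤ) ∣ a ^ 2 + b ^ 2 + c ^ 2) :
    2 ∣ a ∧ 2 ∣ b ∧ 2 ∣ c := by
  -- Squares modulo 4 are 0 or 1; `2 * a = 0` expresses evenness there.
  have key : ∀ a b c : ZMod 4, a ^ 2 + b ^ 2 + c ^ 2 = 0 → 2 * a = 0 ∧ 2 * b = 0 ∧ 2 * c = 0 := by
    decide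
  have h' : (a : ZMod 4) ^ 2 + b ^ 2 + c ^ 2 = 0 := by
    have := (ZMod.intCast_zmod_eq_zero_iff_dvd _ 4).2 h
    simpa using this
  have aux : ∀ x : ℤ, 2 * (x : ZMod 4) = 0 → 2 ∣ x := by
    intro x hx
    have : ((2 * x : ℤ) : ZMod 4) = 0 := by simpa using hx
    have := (ZMod.intCast_zmod_eq_zero_iff_dvd _ 4).1 this
    push_cast at this
    omega
  obtain ⟨ha, hb, hc⟩ := key a b c h'
  exact ⟨aux a ha, aux b hb, aux c hc⟩

/-- Doubling is a bijection, as all coordinates must be even. -/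
theorem card_sumSqRep_three_four_mul (n : ℕ) :
    Nat.card (SumSqRep 3 (4 * n)) = Nat.card (SumSqRep 3 n) := by
  symm
  refine Nat.card_congr (Equiv.ofBijective (fun x => ⟨fun i => 2 * x.1 i, ?_⟩) ⟨?_, ?_⟩)
  · have := x.2
    simp only [mul_pow, ← Finset.mul_sum, this]
    push_cast
    ring
  · intro x y h
    refine Subtype.ext (funext fun i => ?_)
    have := congrFun (congrArg (fun z => z.1) h) i
    simpa using this
  · rintro ⟨x, hx⟩
    rw [Fin.sum_univ_three] at hx
    obtain ⟨h0, h1, h2⟩ := four_dvd_sq_add_sq_add_sq (a := x 0) (b := x 1) (c := x 2)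
      ⟨n, by rw [hx]; push_cast; ring⟩
    have hd : ∀ i, 2 * (x i / 2) = x i := by
      intro i
      fin_cases i <;> simp only [Fin.zero_eta, Fin.mk_one, Fin.reduceFinMk] <;> omega
    refine ⟨⟨fun i => x i / 2, ?_⟩, Subtype.ext (funext hd)⟩
    rw [Fin.sum_univ_three]
    rw [← hd 0, ← hd 1, ← hd 2] at hx
    push_cast at hx
    linarith

theorem card_sumSqRep_three_four_pow_mul (a n : ℕ) :
    Nat.card (SumSqRep 3 (4 ^ a * n)) = Nat.card (SumSqRep 3 n) := by
  induction a with
  | zero => simp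
  | succ a ih => rw [pow_succ', mul_assoc, card_sumSqRep_three_four_mul, ih]

theorem card_sumSqRep_three_eight_mul_add_seven (n : ℕ) :
    Nat.card (SumSqRep 3 (8 * n + 7)) = 0 := by
  rw [Nat.card_eq_zero]
  left
  refine ⟨fun x => ?_⟩
  have hx := x.2
  rw [Fin.sum_univ_three] at hx
  have key : ∀ a b c : ZMod 8, a ^ 2 + b ^ 2 + c ^ 2 ≠ 7 := by decide
  refine key (x.1 0) (x.1 1) (x.1 2) ?_
  have := congrArg (fun z : ℤ => (z : ZMod 8)) hx
  push_cast at this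
  rw [this, show (8 : ZMod 8) = 0 from rfl]
  simp

end SumsOfSquares

/-! ### Four squares and multiplication by 7, through quaternions. -/

section Quaternions

open Quaternion

/-- The integral quaternions `2 ± i ± j ± k`, of norm `7`. -/
def quatNormSeven (s : Bool × Bool × Bool) : ℍ[ℤ] :=
  ⟨2, cond s.1 1 (-1), cond s.2.1 1 (-1), cond s.2.2 1 (-1)⟩

theorem star_mul_quatNormSeven (s : Bool × Bool × Bool) :
    star (quatNormSeven s) * quatNormSeven s = 7 := by
  rw [Quaternion.star_mul_eq_coe]
  obtain ⟨p, q, r⟩ := s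
  cases p <;> cases q <;> cases r <;> rfl

theorem quatNormSeven_mul_star (s : Bool × Bool × Bool) :
    quatNormSeven s * star (quatNormSeven s) = 7 := by
  rw [Quaternion.self_mul_star, ← Quaternion.star_mul_self, star_mul_quatNormSeven]

theorem normSq_quatNormSeven (s : Bool × Bool × Bool) : normSq (quatNormSeven s) = 7 := by
  have := Quaternion.star_mul_self (quatNormSeven s)
  rw [star_mul_quatNormSeven] at this
  exact (congrArg (fun x => x.re) this).symm

/-- The four conditions are the coordinates of `star u * x` for `u = 2 + pi + qj + rk`. One choice
of signs works if `x ≠ 0`, and all 8 if `x = 0`; both counts are 1 modulo 7. -/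
theorem quatNormSeven_count_zmod : ∀ a b c d : ZMod 7, a * a + b * b + c * c + d * d = 0 →
    (∑ s : Bool × Bool × Bool,
      let p : ZMod 7 := cond s.1 1 (-1)
      let q : ZMod 7 := cond s.2.1 1 (-1)
      let r : ZMod 7 := cond s.2.2 1 (-1)
      if 2 * a + p * b + q * c + r * d = 0 ∧ 2 * b - p * a - q * d + r * c = 0 ∧
        2 * c + p * d - q * a - r * b = 0 ∧ 2 * d - p * c + q * b - r * a = 0
      then (1 : ZMod 7) else 0) = 1 := by
  decide +kernel

theorem quaternion_seven_mul (y : ℍ[ℤ]) : 7 * y = (7 : ℤ) • y := by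
  rw [← Quaternion.coe_mul_eq_smul]
  rfl

theorem quaternion_seven_dvd_iff (x : ℍ[ℤ]) :
    (∃ y, x = 7 * y) ↔ (x.re : ZMod 7) = 0 ∧ (x.imI : ZMod 7) = 0 ∧ (x.imJ : ZMod 7) = 0 ∧
      (x.imK : ZMod 7) = 0 := by
  simp only [ZMod.intCast_zmod_eq_zero_iff_dvd, quaternion_seven_mul]
  constructor
  · rintro ⟨y, rfl⟩
    exact ⟨⟨y.re, rfl⟩, ⟨y.imI, rfl⟩, ⟨y.imJ, rfl⟩, ⟨y.imK, rfl⟩⟩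
  · rintro ⟨⟨a, ha⟩, ⟨b, hb⟩, ⟨c, hc⟩, ⟨d, hd⟩⟩
    exact ⟨⟨a, b, c, d⟩, Quaternion.ext _ _ ha hb hc hd⟩

open Classical in
/-- Modulo `7`, an integral quaternion of norm divisible by `7` has exactly one left divisor of the
form `2 ± i ± j ± k`. -/
theorem sum_quatNormSeven_dvd {x : ℍ[ℤ]} (hx : (7 : ℤ) ∣ normSq x) :
    ∑ s : Bool × Bool × Bool,
      (if ∃ y, star (quatNormSeven s) * x = 7 * y then (1 : ZMod 7) else 0) = 1 := by
  have hx' : (x.re : ZMod 7) * x.re + x.imI * x.imI + x.imJ * x.imJ + x.imK * x.imK = 0 := by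
    have := (ZMod.intCast_zmod_eq_zero_iff_dvd _ 7).2 hx
    rw [Quaternion.normSq_def'] at this
    push_cast at this
    linear_combination this
  refine (Finset.sum_congr rfl fun s _ => ?_).trans
    (quatNormSeven_count_zmod x.re x.imI x.imJ x.imK hx')
  dsimp only
  congr 1
  rw [quaternion_seven_dvd_iff, eq_iff_iff]
  obtain ⟨p, q, r⟩ := s
  cases p <;> cases q <;> cases r <;>
    (simp only [Quaternion.re_mul, Quaternion.imI_mul, Quaternion.imJ_mul, Quaternion.imK_mul,
      Quaternion.re_star, Quaternion.imI_star, Quaternion.imJ_star, Quaternion.imK_star]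
     simp only [quatNormSeven, cond_true, cond_false]
     push_cast
     ring_nf)

/-- Integral quaternions of norm `n` are representations of `n` as a sum of four squares. -/
def quaternionEquivSumSqRep (n : ℕ) : {x : ℍ[ℤ] // normSq x = n} ≃ SumSqRep 4 n where
  toFun x := ⟨![x.1.re, x.1.imI, x.1.imJ, x.1.imK], by
    refine Eq.trans ?_ x.2
    rw [Fin.sum_univ_four, Quaternion.normSq_def']
    rfl⟩
  invFun x := ⟨⟨x.1 0, x.1 1, x.1 2, x.1 3⟩, by
    refine (Quaternion.normSq_def' _).trans (Eq.trans ?_ x.2)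
    rw [Fin.sum_univ_four]⟩
  left_inv _ := rfl
  right_inv x := by
    refine Subtype.ext (funext fun i => ?_)
    fin_cases i <;> rfl

instance finite_quaternion_normSq (n : ℕ) : Finite {x : ℍ[ℤ] // normSq x = n} := by
  refine Finite.of_injective
    (β := Set.Icc (fun _ : Fin 4 => -(n : ℤ)) (fun _ => n))
    (fun x => ⟨(quaternionEquivSumSqRep n x).1, ?_⟩) ?_
  · have h (i : Fin 4) : (quaternionEquivSumSqRep n x).1 i ^ 2 ≤ n := by
      exact (Finset.single_le_sum (f := fun i => (quaternionEquivSumSqRep n x).1 i ^ 2)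
        (fun j _ => sq_nonneg _) (Finset.mem_univ i)).trans_eq (quaternionEquivSumSqRep n x).2
    constructor <;> intro i <;> dsimp only <;> nlinarith [h i, Int.natCast_nonneg n]
  · intro x y h
    exact (quaternionEquivSumSqRep n).injective (Subtype.ext (congrArg (fun z => z.1) h))

/-- Left multiplication by `u = 2 ± i ± j ± k` identifies the quaternions of norm `n` with those
of norm `7 n` which are left divisible by `u`. -/
theorem card_left_divisible (n : ℕ) (s : Bool × Bool × Bool) :
    Nat.card {x : {x : ℍ[ℤ] // normSq x = ((7 * n : ℕ) : ℤ)} //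
      ∃ y, star (quatNormSeven s) * x.1 = 7 * y} = Nat.card {x : ℍ[ℤ] // normSq x = n} := by
  symm
  refine Nat.card_congr (Equiv.ofBijective
    (fun y => ⟨⟨quatNormSeven s * y.1, ?_⟩, y.1, ?_⟩) ⟨?_, ?_⟩)
  · rw [map_mul, normSq_quatNormSeven, y.2]
    push_cast
    rfl
  · rw [← mul_assoc, star_mul_quatNormSeven]
  · intro y z h
    have h' : quatNormSeven s * y.1 = quatNormSeven s * z.1 := congrArg (fun w => w.1.1) h
    have hu : quatNormSeven s ≠ 0 := by
      intro h0
      have := normSq_quatNormSeven s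
      rw [h0] at this
      simp at this
    exact Subtype.ext (mul_left_cancel₀ hu h')
  · rintro ⟨⟨x, hx⟩, y, hy⟩
    have h7 : (7 : ℍ[ℤ]) ≠ 0 := by
      intro h
      have := congrArg (fun z => z.re) h
      revert this
      decide
    have hxy : quatNormSeven s * y = x := by
      refine mul_left_cancel₀ h7 ?_
      calc 7 * (quatNormSeven s * y) = quatNormSeven s * (7 * y) := by
            rw [← mul_assoc, ← mul_assoc, (Commute.ofNat_left 7 _).eq]
        _ = 7 * x := by rw [← hy, ← mul_assoc, quatNormSeven_mul_star]
    refine ⟨⟨y, ?_⟩, Subtype.ext (Subtype.ext hxy)⟩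
    rw [← hxy, map_mul, normSq_quatNormSeven] at hx
    push_cast at hx
    linarith

/-- `r₄(7n) ≡ r₄(n)` modulo `7`. -/
theorem card_sumSqRep_four_seven_mul (n : ℕ) :
    (Nat.card (SumSqRep 4 (7 * n)) : ZMod 7) = Nat.card (SumSqRep 4 n) := by
  classical
  rw [← Nat.card_congr (quaternionEquivSumSqRep _), ← Nat.card_congr (quaternionEquivSumSqRep _)]
  have := Fintype.ofFinite {x : ℍ[ℤ] // normSq x = ((7 * n : ℕ) : ℤ)}
  calc (Nat.card {x : ℍ[ℤ] // normSq x = ((7 * n : ℕ) : ℤ)} : ZMod 7)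
      = ∑ x : {x : ℍ[ℤ] // normSq x = ((7 * n : ℕ) : ℤ)}, ∑ s : Bool × Bool × Bool,
          (if ∃ y, star (quatNormSeven s) * x.1 = 7 * y then (1 : ZMod 7) else 0) := by
        rw [Finset.sum_congr rfl fun x _ => sum_quatNormSeven_dvd (x := x.1)
          ⟨n, by rw [x.2]; push_cast; rfl⟩]
        rw [Finset.sum_const, nsmul_one, Finset.card_univ, Nat.card_eq_fintype_card]
    _ = ∑ s : Bool × Bool × Bool, (Nat.card {x : ℍ[ℤ] // normSq x = n} : ZMod 7) := by
        -- Double counting of the pairs `(x, s)` with `x` left divisible by `quatNormSeven s`; the 8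
        -- sign choices count as 1 modulo 7.
        rw [Finset.sum_comm]
        refine Finset.sum_congr rfl fun s _ => ?_
        rw [← card_left_divisible n s, Finset.sum_boole, Nat.card_eq_fintype_card,
          Fintype.card_subtype]
    _ = _ := by
        simp only [Finset.sum_const, Finset.card_univ, Fintype.card_prod, Fintype.card_bool,
          nsmul_eq_mul]
        rw [show ((2 * (2 * 2) : ℕ) : ZMod 7) = 1 from rfl, one_mul]

end Quaternions

/-! ### Extraction of the exponents divisible by 7, and the theorem. -/

section Congruences

open PowerSeries

theorem coeff_rescale_thetaSeries_pow (R : Type*) [CommRing R] (k n : ℕ) :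
    coeff n (rescale (-1) (thetaSeries R) ^ k) = (-1) ^ n * (Nat.card (SumSqRep k n) : R) := by
  rw [← map_pow, coeff_rescale, coeff_thetaSeries_pow]

/-- The coefficients along multiples of `p` of a product with a series in `X ^ p`. -/
theorem coeff_mul_expand {R : Type*} [CommRing R] {p : ℕ} (hp : p ≠ 0) (f g : R⟦X⟧) (n : ℕ) :
    coeff (p * n) (f * expand p hp g) =
      coeff n (PowerSeries.mk (fun m => coeff (p * m) f) * g) := by
  rw [coeff_mul, coeff_mul]
  symm
  refine Finset.sum_of_injOn (fun x => (p * x.1, p * x.2)) ?_ ?_ ?_ ?_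
  · rintro ⟨a, b⟩ _ ⟨c, d⟩ _ h
    simpa [hp] using h
  · rintro ⟨a, b⟩ h
    simp only [Finset.mem_coe, Finset.HasAntidiagonal.mem_antidiagonal] at h ⊢
    rw [← mul_add, h]
  · rintro ⟨a, b⟩ h hn
    rw [Finset.HasAntidiagonal.mem_antidiagonal] at h
    rw [coeff_expand_of_not_dvd p hp g, mul_zero]
    rintro ⟨d, rfl⟩
    obtain ⟨c, rfl⟩ : p ∣ a := (Nat.dvd_add_left ⟨d, rfl⟩).1 ⟨n, h⟩
    refine hn ⟨(c, d), ?_, rfl⟩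
    rw [Finset.mem_coe, Finset.HasAntidiagonal.mem_antidiagonal]
    exact Nat.eq_of_mul_eq_mul_left (Nat.pos_of_ne_zero hp) (by rw [mul_add, h])
  · rintro ⟨a, b⟩ _
    simp

/-- Frobenius fixes the coefficients in `ZMod p`. -/
theorem expand_eq_pow_zmod (p : ℕ) [Fact p.Prime] (hp : p ≠ 0) (f : (ZMod p)⟦X⟧) :
    expand p hp f = f ^ p := by
  have := MvPowerSeries.map_frobenius_expand p hp (f := f)
  rw [ZMod.frobenius_zmod, MvPowerSeries.map_id] at this
  exact this

/-- `p̄₃(7n) ≡ (-1)ⁿ r₃(n)` modulo `7`. -/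
theorem overpartitionTupleCount_three_seven_mul (n : ℕ) :
    (overpartitionTupleCount 3 (7 * n) : ZMod 7) = (-1) ^ n * Nat.card (SumSqRep 3 n) := by
  let _ : TopologicalSpace (ZMod 7) := ⊥
  have : DiscreteTopology (ZMod 7) := ⟨rfl⟩
  have : Fact (Nat.Prime 7) := ⟨by norm_num⟩
  have h7 : (7 : ℕ) ≠ 0 := by norm_num
  have hinv := rescale_theta_mul_overpartitionSeries (ZMod 7)
  set φ := rescale (-1) (thetaSeries (ZMod 7)) with hφ
  set Ω := overpartitionSeries (ZMod 7) with hΩ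
  have hmul : PowerSeries.mk (fun m => coeff (7 * m) (Ω ^ 3)) * φ = φ ^ 4 := by
    ext m
    have h4 : Ω ^ 3 * φ ^ 7 = φ ^ 4 := by
      calc Ω ^ 3 * φ ^ 7 = (φ * Ω) ^ 3 * φ ^ 4 := by ring
        _ = φ ^ 4 := by rw [hinv, one_pow, one_mul]
    rw [← coeff_mul_expand h7, expand_eq_pow_zmod 7, h4, coeff_rescale_thetaSeries_pow,
      coeff_rescale_thetaSeries_pow, card_sumSqRep_four_seven_mul, pow_mul,
      Odd.neg_one_pow (by decide : Odd 7)]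
  have hcube : PowerSeries.mk (fun m => coeff (7 * m) (Ω ^ 3)) = φ ^ 3 := by
    calc PowerSeries.mk (fun m => coeff (7 * m) (Ω ^ 3))
        = PowerSeries.mk (fun m => coeff (7 * m) (Ω ^ 3)) * φ * Ω := by
          rw [mul_assoc, hinv, mul_one]
      _ = φ ^ 3 * (φ * Ω) := by rw [hmul]; ring
      _ = φ ^ 3 := by rw [hinv, mul_one]
  rw [← coeff_rescale_thetaSeries_pow, ← hφ, ← hcube, coeff_mk, hΩ, coeff_overpartitionSeries_pow]

end Congruences

theorem mainTheorem3 (α n : ℕ) :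
    ((overpartitionTupleCount 3 (7 * 4 ^ (α + 1) * n) : ℤ) ≡
        (-1) ^ n * (overpartitionTupleCount 3 (7 * n) : ℤ) [ZMOD 7]) ∧
      ((overpartitionTupleCount 3 (4 ^ α * (56 * n + 49)) : ℤ) ≡ 0 [ZMOD 7]) := by
  constructor
  · refine (ZMod.intCast_eq_intCast_iff _ _ 7).1 ?_
    push_cast
    rw [mul_assoc, overpartitionTupleCount_three_seven_mul, overpartitionTupleCount_three_seven_mul,
      card_sumSqRep_three_four_pow_mul, ← mul_assoc, ← mul_pow]
    -- The sign on the left is thus `+1`, while on the right the two factors `(-1)^n` cancel.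
    have heven : Even (4 ^ (α + 1) * n) :=
      ((by decide : Even 4).pow_of_ne_zero α.succ_ne_zero).mul_right n
    simp [heven.neg_one_pow]
  · refine (ZMod.intCast_eq_intCast_iff _ _ 7).1 ?_
    push_cast
    rw [show 4 ^ α * (56 * n + 49) = 7 * (4 ^ α * (8 * n + 7)) by ring,
      overpartitionTupleCount_three_seven_mul, card_sumSqRep_three_four_pow_mul,
      card_sumSqRep_three_eight_mul_add_seven]
    simp
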